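/- Fix $n\ge 0$ and variables $p_1,\dots,p_n$. Formulas are those of intuitionistic propositional logic (IPC) in these variables (with $\bot,\top,\wedge,\vee,\to$; $\bigwedge\emptyset=\top$, $\bigvee\emptyset=\bot$). A $(\wedge,\to)$-formula is one in which neither $\vee$ nor $\bot$ occurs. A model is a poset $M$ with an order-preserving colouring $c:M\to 2^n$, with the usual Kripke semantics, and $v(\varphi)$ is the set of points of $M$ satisfying $\varphi$. A point is a $q$-border point if it is a maximal point of $M\setminus v(q)$, and it is separated if it is a $q$-border point for some variable $q$; $M^s$ is the submodel of separated points. A p-morphism of models is an order-preserving, colour-preserving map $f:M\to N$ such that $f(x)\le y$ implies $y=f(x')$ for some $x'\ge x$. The canonical model consists of the consistent deductively closed sets of formulas with the disjunction property, ordered by inclusion, where $p_i$ is true at $x$ if and only if $p_i\in x$. The universal model $U(n)$ is its submodel of the points $x$ for which ${\uparrow}x$ is finite. For $w\in U(n)$, with set $I_w$ of immediate successors, define by recursion the de Jongh formulas $$\theta_w=\bigvee_{w'\in I_w}\varphi_{w'},\qquad \varphi_w=\bigwedge_{p\in T_w}p\wedge\bigwedge_{q\in B_w}(q\to\theta_w)\wedge\bigwedge_{w'\in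 I_w}\big((\varphi_{w'}\to\theta_{w'})\to\theta_w\big),$$ where $T_w$ is the set of variables true at $w$ and $B_w$ the set of variables $q$ such that $w$ is a $q$-border point. For a formula $\varphi$, let $s(\varphi)$ be obtained by replacing each $\bot$ by $p_1\wedge\dots\wedge p_n$ and each $\vee$ by the join $\veebar$ of the fragment: $\sigma\veebar\tau$ is a least upper bound of $\sigma$ and $\tau$ among the $(\wedge,\to)$-formulas preordered by IPC-provability; it is determined up to provable equivalence, and any representative may be used. **Theorem.** There is exactly one p-morphism $f:U(n)^s\to U(n)$. Let $U(n)_{\wedge,\to}$ be its image, as a submodel of $U(n)$. It is a finite up-set of $U(n)$. The formula $s(\varphi)$ exists and is a $(\wedge,\to)$-formula, for every formula $\varphi$. For every up-set $U$ of $U(n)_{\wedge,\to}$: 1. $U$ is definable by a $(\wedge,\to)$-formula, i.e. $U=v(\chi)$ in the model $U(n)_{\wedge,\to}$ for some $(\wedge,\to)$-formula $\chi$; if $n\ge1$, $\chi$ can be chosen without $\top$. 2. Concretely, with $\varphi_U:=\bigvee_{u\in\min(U)}\varphi_u$, where $\min(U)$ is the set of minimal points of $U$, the formula $s(\varphi_U)$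 defines $U$ in $U(n)_{\wedge,\to}$. -/

import Mathlib

namespace MeetImp

/-- Formulas of intuitionistic propositional logic in the variables `p_0, …, p_{n-1}`. -/
inductive Formula (n : ℕ) : Type
  | var : Fin n → Formula n
  | bot : Formula n
  | top : Formula n
  | conj : Formula n → Formula n → Formula n
  | disj : Formula n → Formula n → Formula n
  | imp : Formula n → Formula n → Formula n

namespace Formula

/-- Finite conjunctions; the empty one is `⊤`. -/
def bigAnd {n : ℕ} : List (Formula n) → Formula n
  | [] => top
  | [φ] => φ
  | φ :: ψ :: l => conj φ (bigAnd (ψ :: l))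

/-- Finite disjunctions; the empty one is `⊥`. -/
def bigOr {n : ℕ} : List (Formula n) → Formula n
  | [] => bot
  | [φ] => φ
  | φ :: ψ :: l => disj φ (bigOr (ψ :: l))

/-- The formulas of the meet-implication fragment, in the signature of implicative
meet-semilattices with their largest element: no `⊥` and no `∨` occurs. -/
def IsMeetImp {n : ℕ} : Formula n → Prop
  | var _ => True
  | bot => False
  | top => True
  | conj φ ψ => IsMeetImp φ ∧ IsMeetImp ψ
  | disj _ _ => False
  | imp φ ψ => IsMeetImp φ ∧ IsMeetImp ψ

/-- The constant `⊤` does not occur in the formula. -/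
def OmitsTop {n : ℕ} : Formula n → Prop
  | var _ => True
  | bot => True
  | top => False
  | conj φ ψ => OmitsTop φ ∧ OmitsTop ψ
  | disj φ ψ => OmitsTop φ ∧ OmitsTop ψ
  | imp φ ψ => OmitsTop φ ∧ OmitsTop ψ

end Formula

open Formula

/-- Natural deduction for IPC: `Proves Γ φ` says that `φ` is derivable from `Γ`. -/
inductive Proves {n : ℕ} : Set (Formula n) → Formula n → Prop
  | ax {Γ : Set (Formula n)} {φ : Formula n} : φ ∈ Γ → Proves Γ φ
  | botE {Γ : Set (Formula n)} {φ : Formula n} : Proves Γ bot → Proves Γ φ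
  | topI {Γ : Set (Formula n)} : Proves Γ top
  | andI {Γ : Set (Formula n)} {φ ψ : Formula n} :
      Proves Γ φ → Proves Γ ψ → Proves Γ (conj φ ψ)
  | andE₁ {Γ : Set (Formula n)} {φ ψ : Formula n} : Proves Γ (conj φ ψ) → Proves Γ φ
  | andE₂ {Γ : Set (Formula n)} {φ ψ : Formula n} : Proves Γ (conj φ ψ) → Proves Γ ψ
  | orI₁ {Γ : Set (Formula n)} {φ ψ : Formula n} : Proves Γ φ → Proves Γ (disj φ ψ)
  | orI₂ {Γ : Set (Formula n)} {φ ψ : Formula n} : Proves Γ ψ → Proves Γ (disj φ ψ)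
  | orE {Γ : Set (Formula n)} {φ ψ χ : Formula n} :
      Proves Γ (disj φ ψ) → Proves (insert φ Γ) χ → Proves (insert ψ Γ) χ → Proves Γ χ
  | impI {Γ : Set (Formula n)} {φ ψ : Formula n} :
      Proves (insert φ Γ) ψ → Proves Γ (imp φ ψ)
  | impE {Γ : Set (Formula n)} {φ ψ : Formula n} :
      Proves Γ (imp φ ψ) → Proves Γ φ → Proves Γ ψ

/-- The Lindenbaum preorder: `ψ` is provable from `φ` in IPC. -/
def Entails {n : ℕ} (φ ψ : Formula n) : Prop := Proves {φ} ψ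

/-! ### Kripke models

A model is a poset `M` with a colouring, an order-preserving map `c` from `M` to `2^n`, which is
here the power set of the set of (indices of) variables. -/

/-- Satisfaction of a formula at a point of the model `(M, ≤, c)`. -/
def Sat {n : ℕ} {M : Type*} [PartialOrder M] (c : M →o Set (Fin n)) : M → Formula n → Prop
  | x, var i => i ∈ c x
  | _, bot => False
  | _, top => True
  | x, conj φ ψ => Sat c x φ ∧ Sat c x ψ
  | x, disj φ ψ => Sat c x φ ∨ Sat c x ψ
  | x, imp φ ψ => ∀ y, x ≤ y → Sat c y φ → Sat c y ψ

/-- The subset of the model that is defined by a formula. -/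
def val {n : ℕ} {M : Type*} [PartialOrder M] (c : M →o Set (Fin n)) (φ : Formula n) : Set M :=
  {x | Sat c x φ}

/-- `x` is a `q`-border point: a maximal point of the complement of `val c q`. -/
def IsBorder {n : ℕ} {M : Type*} [PartialOrder M] (c : M →o Set (Fin n)) (q : Fin n) (x : M) :
    Prop :=
  Maximal (fun y => y ∉ val c (var q)) x

/-- Separated points: `q`-border points for some variable `q`. -/
def Separated {n : ℕ} {M : Type*} [PartialOrder M] (c : M →o Set (Fin n)) (x : M) : Prop :=
  ∃ q : Fin n, IsBorder c q x

/-- The colouring of the submodel on the points satisfying `S`. -/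
def restrict {n : ℕ} {M : Type*} [PartialOrder M] (c : M →o Set (Fin n)) (S : M → Prop) :
    {x : M // S x} →o Set (Fin n) :=
  c.comp (OrderHom.Subtype.val S)

/-- p-morphisms of models. -/
structure IsPMorphism {n : ℕ} {M N : Type*} [PartialOrder M] [PartialOrder N]
    (c : M →o Set (Fin n)) (d : N →o Set (Fin n)) (f : M → N) : Prop where
  monotone : Monotone f
  back : ∀ (x : M) (y : N), f x ≤ y → ∃ x' : M, x ≤ x' ∧ f x' = y
  colour : ∀ x : M, d (f x) = c x

/-! ### The canonical and the universal model -/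

/-- Theories with the disjunction property: consistent deductively closed sets of formulas `T`
such that `φ ∨ ψ ∈ T` implies `φ ∈ T` or `ψ ∈ T`. They are the (inverse images of the) prime
filters of the Lindenbaum algebra, that is, of the free Heyting algebra on `n` generators. -/
structure IsPrimeTheory {n : ℕ} (T : Set (Formula n)) : Prop where
  closed : ∀ φ, Proves T φ → φ ∈ T
  consistent : bot ∉ T
  prime : ∀ φ ψ, disj φ ψ ∈ T → φ ∈ T ∨ ψ ∈ T

/-- The canonical frame `C(n)`, ordered by inclusion. -/
abbrev Canonical (n : ℕ) : Type := {T : Set (Formula n) // IsPrimeTheory T}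

/-- The colouring of the canonical model. -/
def canonicalColour (n : ℕ) : Canonical n →o Set (Fin n) where
  toFun x := {i | var i ∈ x.1}
  monotone' := fun _ _ hxy _ hi => hxy hi

/-- The universal model `U(n)`: the image-finite part of the canonical model. -/
abbrev Univ (n : ℕ) : Type := {x : Canonical n // (Set.Ici x).Finite}

/-- The colouring of the universal model. -/
def univColour (n : ℕ) : Univ n →o Set (Fin n) :=
  restrict (canonicalColour n) (fun x => (Set.Ici x).Finite)

theorem univ_finite_Ici {n : ℕ} (w : Univ n) : (Set.Ici w).Finite := by
  have h : ((Subtype.val : Univ n → Canonical n) ⁻¹' Set.Ici w.1).Finite :=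
    w.2.preimage Subtype.val_injective.injOn
  exact h

instance {n : ℕ} : WellFoundedGT (Univ n) := by
  refine ⟨⟨fun a => ?_⟩⟩
  have key : ∀ (k : ℕ) (x : Univ n), (Set.Ici x).ncard = k → Acc (· > ·) x := by
    intro k
    induction k using Nat.strong_induction_on with
    | _ k ih =>
      intro x hx
      refine Acc.intro _ fun y hy => ih _ ?_ y rfl
      rw [← hx]
      exact Set.ncard_lt_ncard (Set.Ici_ssubset_Ici.2 hy) (univ_finite_Ici x)
  exact key _ a rfl

/-! ### The model `M_{∧,→}` -/

/-- The underlying set of `M_{∧,→}`: the image of the p-morphism `M^s → U(n)`, where `M^s` is the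
submodel of the separated points of `M`. (This p-morphism exists and is unique.) -/
def meetImpSet {n : ℕ} {M : Type*} [PartialOrder M] (c : M →o Set (Fin n)) : Set (Univ n) :=
  {y | ∃ f : {x : M // Separated c x} → Univ n,
    IsPMorphism (restrict c (Separated c)) (univColour n) f ∧ y ∈ Set.range f}

/-- The model `U(n)_{∧,→}`, a submodel of `U(n)`. -/
abbrev UnivMeetImp (n : ℕ) : Type := {y : Univ n // y ∈ meetImpSet (univColour n)}

/-- The colouring of `U(n)_{∧,→}`. -/
def univMeetImpColour (n : ℕ) : UnivMeetImp n →o Set (Fin n) :=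
  restrict (univColour n) (fun y => y ∈ meetImpSet (univColour n))

/-! ### De Jongh formulas -/

open Classical in
/-- An enumeration without repetition of a finite type (empty if the type is infinite). -/
noncomputable def enum (α : Type) : List α :=
  if h : Finite α then (@Finset.univ α (@Fintype.ofFinite α h)).toList else []

/-- The pair `(θ_w, φ_w)` of de Jongh formulas, by recursion from the top of `U(n)`; here
`w ⋖ w'` says that `w'` is an immediate successor of `w`. (As `Set.Ici w` is finite, so is the
type of immediate successors.) -/
noncomputable def deJongh {n : ℕ} (w : Univ n) : Formula n × Formula n :=
  let succs : List (Formula n × Formula n) :=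
    (enum {w' : Univ n // w ⋖ w'}).map fun w' => deJongh w'.1
  let θ : Formula n := bigOr (succs.map fun t => t.2)
  (θ,
    conj (bigAnd ((enum {p : Fin n // w ∈ val (univColour n) (var p)}).map fun p => var p.1))
      (conj (bigAnd ((enum {q : Fin n // IsBorder (univColour n) q w}).map
          fun q => imp (var q.1) θ))
        (bigAnd (succs.map fun t => imp (imp t.2 t.1) θ))))
termination_by wellFounded_gt.wrap w
decreasing_by exact w'.2.lt

/-- The formula `φ_w`. -/
noncomputable def deJonghPhi {n : ℕ} (w : Univ n) : Formula n := (deJongh w).2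

/-- The formula `φ_U`: the disjunction of the formulas `φ_u` over the minimal points `u` of `U`. -/
noncomputable def upSetFormula {n : ℕ} (U : Set (UnivMeetImp n)) : Formula n :=
  bigOr ((enum {u : UnivMeetImp n // Minimal (fun x => x ∈ U) u}).map fun u => deJonghPhi u.1.1)

/-! ### The translation `s` -/

/-- `ρ` represents the join of `σ` and `τ` in the Lindenbaum algebra of the meet-implication
fragment. -/
structure IsMeetImpJoin {n : ℕ} (σ τ ρ : Formula n) : Prop where
  mem : ρ.IsMeetImp
  left : Entails σ ρ
  right : Entails τ ρ
  least : ∀ χ : Formula n, χ.IsMeetImp → Entails σ χ → Entails τ χ → Entails ρ χ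

/-- `Translates φ σ`: `σ` is a result `s(φ)` of replacing, in `φ`, each `⊥` by `p_1 ∧ ⋯ ∧ p_n` and
each `∨` by the join of the meet-implication fragment. That join is determined only up to
provable equivalence, so that `σ` may use any representative. -/
inductive Translates {n : ℕ} : Formula n → Formula n → Prop
  | var (i : Fin n) : Translates (var i) (var i)
  | bot : Translates bot (bigAnd ((List.finRange n).map Formula.var))
  | top : Translates top top
  | conj {φ ψ σ τ : Formula n} :
      Translates φ σ → Translates ψ τ → Translates (conj φ ψ) (conj σ τ)
  | imp {φ ψ σ τ : Formula n} :
      Translates φ σ → Translates ψ τ → Translates (imp φ ψ) (imp σ τ)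
  | disj {φ ψ σ τ ρ : Formula n} :
      Translates φ σ → Translates ψ τ → IsMeetImpJoin σ τ ρ → Translates (disj φ ψ) ρ

end MeetImp

namespace MeetImp

open Formula

variable {n : ℕ}

/-! ### Natural deduction -/

/-! Sending a point of an image-finite model to its theory is a p-morphism into `U(n)`
(`isPMorphism_toUniv`). It is the only one, since p-morphisms preserve theories and a point of
`U(n)` is its theory. Applied to the separated points, this yields N = `U(n)_{∧,→}`.

Truth of a (∧,→)-formula at a point depends only on the separated points above it
(`sat_iff_separated`). With completeness of `U(n)`, obtained by filtration, provability between such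
formulas is therefore inclusion of their valuations in N (`entails_iff_val_subset`).

Every point of N is again separated, so colours strictly increase along the order, and a point is
determined by its colour and its proper successors. Hence N is finite, and an induction from large
colours to small ones defines the complement of each principal down-set
(`meetImpDefinable_compl_Iic`); intersections of these give all up-sets.

So unions of definable up-sets are definable, and the join of the fragment is interpreted in N as
union. Moreover p_1 ∧ ⋯ ∧ p_n holds nowhere in N, as a separated point falsifies some variable. Thus
s(φ) and φ agree on N, and the last claim reduces to de Jongh's theorem that φ_w defines the up-set
generated by w (`sat_deJonghPhi_iff`). -/

theorem Proves.weaken {Γ Δ : Set (Formula n)} {φ : Formula n} (h : Proves Γ φ) (hs : Γ ⊆ Δ) :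
    Proves Δ φ := by
  induction h generalizing Δ with
  | ax h => exact .ax (hs h)
  | botE _ ih => exact .botE (ih hs)
  | topI => exact .topI
  | andI _ _ ih₁ ih₂ => exact .andI (ih₁ hs) (ih₂ hs)
  | andE₁ _ ih => exact .andE₁ (ih hs)
  | andE₂ _ ih => exact .andE₂ (ih hs)
  | orI₁ _ ih => exact .orI₁ (ih hs)
  | orI₂ _ ih => exact .orI₂ (ih hs)
  | orE _ _ _ ih ih₁ ih₂ =>
    exact .orE (ih hs) (ih₁ (Set.insert_subset_insert hs)) (ih₂ (Set.insert_subset_insert hs))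
  | impI _ ih => exact .impI (ih (Set.insert_subset_insert hs))
  | impE _ _ ih₁ ih₂ => exact .impE (ih₁ hs) (ih₂ hs)

theorem Proves.cut {Γ : Set (Formula n)} {φ ψ : Formula n} (h : Proves Γ φ)
    (h' : Proves (insert φ Γ) ψ) : Proves Γ ψ :=
  .impE (.impI h') h

theorem Proves.exists_finite {Γ : Set (Formula n)} {φ : Formula n} (h : Proves Γ φ) :
    ∃ F ⊆ Γ, F.Finite ∧ Proves F φ := by
  have discharge {Γ F : Set (Formula n)} {φ : Formula n} (h : F ⊆ insert φ Γ) :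
      F \ {φ} ⊆ Γ ∧ F ⊆ insert φ (F \ {φ}) := by
    refine ⟨fun x hx => (h hx.1).resolve_left hx.2, fun x hx => ?_⟩
    by_cases e : x = φ
    · exact .inl e
    · exact .inr ⟨hx, e⟩
  induction h with
  | @ax Γ φ h => exact ⟨{φ}, by simpa using h, Set.finite_singleton _, .ax rfl⟩
  | botE _ ih => obtain ⟨F, hF, hf, h⟩ := ih; exact ⟨F, hF, hf, .botE h⟩
  | topI => exact ⟨∅, Set.empty_subset _, Set.finite_empty, .topI⟩
  | andI _ _ ih₁ ih₂ =>
    obtain ⟨F, hF, hf, h⟩ := ih₁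
    obtain ⟨G, hG, hg, h'⟩ := ih₂
    exact ⟨F ∪ G, Set.union_subset hF hG, hf.union hg,
      .andI (h.weaken Set.subset_union_left) (h'.weaken Set.subset_union_right)⟩
  | andE₁ _ ih => obtain ⟨F, hF, hf, h⟩ := ih; exact ⟨F, hF, hf, .andE₁ h⟩
  | andE₂ _ ih => obtain ⟨F, hF, hf, h⟩ := ih; exact ⟨F, hF, hf, .andE₂ h⟩
  | orI₁ _ ih => obtain ⟨F, hF, hf, h⟩ := ih; exact ⟨F, hF, hf, .orI₁ h⟩
  | orI₂ _ ih => obtain ⟨F, hF, hf, h⟩ := ih; exact ⟨F, hF, hf, .orI₂ h⟩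
  | @orE Γ φ ψ χ _ _ _ ih ih₁ ih₂ =>
    obtain ⟨F, hF, hf, h⟩ := ih
    obtain ⟨G₁, hG₁, hg₁, h₁⟩ := ih₁
    obtain ⟨G₂, hG₂, hg₂, h₂⟩ := ih₂
    refine ⟨F ∪ (G₁ \ {φ} ∪ G₂ \ {ψ}),
      Set.union_subset hF (Set.union_subset (discharge hG₁).1 (discharge hG₂).1),
      hf.union (hg₁.sdiff.union hg₂.sdiff), .orE (h.weaken Set.subset_union_left)
        (h₁.weaken ((discharge hG₁).2.trans (Set.insert_subset_insert ?_)))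
        (h₂.weaken ((discharge hG₂).2.trans (Set.insert_subset_insert ?_)))⟩
    · exact Set.subset_union_left.trans Set.subset_union_right
    · exact Set.subset_union_right.trans Set.subset_union_right
  | @impI Γ φ ψ _ ih =>
    obtain ⟨F, hF, hf, h⟩ := ih
    exact ⟨F \ {φ}, (discharge hF).1, hf.sdiff, .impI (h.weaken (discharge hF).2)⟩
  | impE _ _ ih₁ ih₂ =>
    obtain ⟨F, hF, hf, h⟩ := ih₁
    obtain ⟨G, hG, hg, h'⟩ := ih₂
    exact ⟨F ∪ G, Set.union_subset hF hG, hf.union hg,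
      .impE (h.weaken Set.subset_union_left) (h'.weaken Set.subset_union_right)⟩

/-- Lindenbaum's lemma. -/
theorem exists_canonical {Γ : Set (Formula n)} {ψ : Formula n} (h : ¬ Proves Γ ψ) :
    ∃ T : Canonical n, Γ ⊆ T.1 ∧ ψ ∉ T.1 := by
  obtain ⟨T, hΓT, hT⟩ := zorn_subset_nonempty {Δ : Set (Formula n) | ¬ Proves Δ ψ} (by
    intro c hc hchain hne
    refine ⟨⋃₀ c, fun hp => ?_, fun s hs => Set.subset_sUnion_of_mem hs⟩
    obtain ⟨F, hF, hf, hFp⟩ := hp.exists_finite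
    obtain ⟨s, hs, hFs⟩ :=
      DirectedOn.exists_mem_subset_of_finite_of_subset_sUnion hne hchain.directedOn hf hF
    exact hc hs (hFp.weaken hFs)) Γ h
  -- By maximality, adding any formula outside `T` makes `ψ` derivable; closure and primality both
  -- follow from this.
  have hins : ∀ φ, φ ∉ T → Proves (insert φ T) ψ := by
    intro φ hφ
    by_contra hc
    exact hφ (hT.le_of_ge hc (Set.subset_insert φ T) (Set.mem_insert φ T))
  have hn : ¬ Proves T ψ := hT.prop
  refine ⟨⟨T, ?_, ?_, ?_⟩, hΓT, fun hψ => hn (.ax hψ)⟩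
  · intro φ hφ
    by_contra hc
    exact hn (hφ.cut (hins φ hc))
  · exact fun hb => hn (.botE (.ax hb))
  · intro φ χ hd
    by_contra! hc
    exact hn (.orE (.ax hd) (hins φ hc.1) (hins χ hc.2))

theorem IsPrimeTheory.mem_conj {T : Set (Formula n)} (hT : IsPrimeTheory T) {φ ψ : Formula n} :
    conj φ ψ ∈ T ↔ φ ∈ T ∧ ψ ∈ T :=
  ⟨fun h => ⟨hT.closed _ (.andE₁ (.ax h)), hT.closed _ (.andE₂ (.ax h))⟩,
    fun h => hT.closed _ (.andI (.ax h.1) (.ax h.2))⟩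

theorem IsPrimeTheory.mem_disj {T : Set (Formula n)} (hT : IsPrimeTheory T) {φ ψ : Formula n} :
    disj φ ψ ∈ T ↔ φ ∈ T ∨ ψ ∈ T :=
  ⟨hT.prime _ _, fun h => h.elim (fun h => hT.closed _ (.orI₁ (.ax h)))
    (fun h => hT.closed _ (.orI₂ (.ax h)))⟩

theorem IsPrimeTheory.mem_of_imp {T : Set (Formula n)} (hT : IsPrimeTheory T) {φ ψ : Formula n}
    (h : imp φ ψ ∈ T) (h' : φ ∈ T) : ψ ∈ T :=
  hT.closed _ (.impE (.ax h) (.ax h'))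

/-- The implication case of the truth lemmas, for the canonical model and for its filtrations. -/
theorem Canonical.exists_of_imp_notMem (T : Canonical n) {φ ψ : Formula n} (h : imp φ ψ ∉ T.1) :
    ∃ T' : Canonical n, T ≤ T' ∧ φ ∈ T'.1 ∧ ψ ∉ T'.1 := by
  have hn : ¬ Proves (insert φ T.1) ψ := fun hp => h (T.2.closed _ (.impI hp))
  obtain ⟨T', hs, hψ⟩ := exists_canonical hn
  exact ⟨T', (Set.subset_insert _ _).trans hs, hs (Set.mem_insert _ _), hψ⟩

/-! ### Kripke semantics -/

section Semantics

variable {M : Type*} [PartialOrder M] {c : M →o Set (Fin n)}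

theorem Sat.mono {x y : M} {φ : Formula n} (h : Sat c x φ) (hxy : x ≤ y) : Sat c y φ := by
  induction φ with
  | var i => exact c.monotone hxy h
  | bot => exact h
  | top => trivial
  | conj φ ψ ih₁ ih₂ => exact ⟨ih₁ h.1, ih₂ h.2⟩
  | disj φ ψ ih₁ ih₂ => exact h.imp ih₁ ih₂
  | imp φ ψ ih₁ ih₂ => exact fun z hz => h z (hxy.trans hz)

theorem isUpperSet_val (φ : Formula n) : IsUpperSet (val c φ) := fun _ _ hxy h => Sat.mono h hxy

/-- Soundness of natural deduction for Kripke models. -/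
theorem Proves.sat {Γ : Set (Formula n)} {φ : Formula n} (h : Proves Γ φ) {x : M}
    (hx : ∀ γ ∈ Γ, Sat c x γ) : Sat c x φ := by
  induction h generalizing x with
  | ax h => exact hx _ h
  | botE _ ih => exact (ih hx).elim
  | topI => trivial
  | andI _ _ ih₁ ih₂ => exact ⟨ih₁ hx, ih₂ hx⟩
  | andE₁ _ ih => exact (ih hx).1
  | andE₂ _ ih => exact (ih hx).2
  | orI₁ _ ih => exact .inl (ih hx)
  | orI₂ _ ih => exact .inr (ih hx)
  | orE _ _ _ ih ih₁ ih₂ =>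
    rcases ih hx with h | h
    · exact ih₁ (Set.forall_mem_insert.2 ⟨h, hx⟩)
    · exact ih₂ (Set.forall_mem_insert.2 ⟨h, hx⟩)
  | impI _ ih =>
    exact fun y hxy hy => ih (Set.forall_mem_insert.2 ⟨hy, fun γ hγ => (hx γ hγ).mono hxy⟩)
  | impE _ _ ih₁ ih₂ => exact ih₁ hx _ le_rfl (ih₂ hx)

theorem Entails.val_subset {φ ψ : Formula n} (h : Entails φ ψ) : val c φ ⊆ val c ψ :=
  fun _ hx => Proves.sat h (by rintro γ rfl; exact hx)

theorem sat_bigAnd {x : M} {l : List (Formula n)} :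
    Sat c x (bigAnd l) ↔ ∀ φ ∈ l, Sat c x φ := by
  induction l with
  | nil => simp [bigAnd, Sat]
  | cons φ l ih =>
    cases l with
    | nil => simp [bigAnd]
    | cons ψ l => rw [List.forall_mem_cons, ← ih]; rfl

theorem sat_bigOr {x : M} {l : List (Formula n)} :
    Sat c x (bigOr l) ↔ ∃ φ ∈ l, Sat c x φ := by
  induction l with
  | nil => simp [bigOr, Sat]
  | cons φ l ih =>
    cases l with
    | nil => simp [bigOr]
    | cons ψ l => rw [List.exists_mem_cons_iff, ← ih]; rfl

theorem IsPMorphism.sat_iff {N : Type*} [PartialOrder N] {d : N →o Set (Fin n)} {f : M → N}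
    (hf : IsPMorphism c d f) (φ : Formula n) (x : M) : Sat d (f x) φ ↔ Sat c x φ := by
  induction φ generalizing x with
  | var i => change i ∈ d (f x) ↔ i ∈ c x; rw [hf.colour]
  | bot => exact Iff.rfl
  | top => exact Iff.rfl
  | conj φ ψ ih₁ ih₂ => exact and_congr (ih₁ x) (ih₂ x)
  | disj φ ψ ih₁ ih₂ => exact or_congr (ih₁ x) (ih₂ x)
  | imp φ ψ ih₁ ih₂ =>
    constructor
    · exact fun h y hxy hy => (ih₂ y).1 (h _ (hf.monotone hxy) ((ih₁ y).2 hy))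
    · intro h y hxy hy
      obtain ⟨x', hx', rfl⟩ := hf.back x y hxy
      exact (ih₂ x').2 (h x' hx' ((ih₁ x').1 hy))

theorem sat_restrict_iff {S : M → Prop} (hS : ∀ x y, x ≤ y → S x → S y) (φ : Formula n)
    (x : {x : M // S x}) : Sat (restrict c S) x φ ↔ Sat c x.1 φ :=
  (IsPMorphism.sat_iff (f := Subtype.val) ⟨fun _ _ h => h,
    fun x y hxy => ⟨⟨y, hS _ _ hxy x.2⟩, hxy, rfl⟩, fun _ => rfl⟩ φ x).symm

/-- Points with the same colour and the same proper successors satisfy the same formulas. -/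
theorem sat_congr_of_Ioi_eq {x y : M} (hc : c x = c y) (hI : Set.Ioi x = Set.Ioi y)
    (φ : Formula n) : Sat c x φ ↔ Sat c y φ := by
  induction φ with
  | var i => change i ∈ c x ↔ i ∈ c y; rw [hc]
  | bot => exact Iff.rfl
  | top => exact Iff.rfl
  | conj φ ψ ih₁ ih₂ => exact and_congr ih₁ ih₂
  | disj φ ψ ih₁ ih₂ => exact or_congr ih₁ ih₂
  | imp φ ψ ih₁ ih₂ =>
    have split (x : M) : Sat c x (imp φ ψ) ↔
        (Sat c x φ → Sat c x ψ) ∧ ∀ z ∈ Set.Ioi x, Sat c z φ → Sat c z ψ := by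
      refine ⟨fun h => ⟨h x le_rfl, fun z hz => h z (le_of_lt hz)⟩, fun h z hz => ?_⟩
      rcases hz.eq_or_lt with rfl | hz
      · exact h.1
      · exact h.2 z hz
    rw [split, split, ih₁, ih₂, hI]

/-- A point with a single immediate successor of the same colour satisfies the same formulas as
that successor. -/
theorem sat_congr_of_Ioi_eq_Ici {x y : M} (hc : c x = c y) (hI : Set.Ioi x = Set.Ici y)
    (φ : Formula n) : Sat c x φ ↔ Sat c y φ := by
  have hxy : x ≤ y := le_of_lt (by rw [← Set.mem_Ioi, hI]; exact le_rfl)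
  induction φ with
  | var i => change i ∈ c x ↔ i ∈ c y; rw [hc]
  | bot => exact Iff.rfl
  | top => exact Iff.rfl
  | conj φ ψ ih₁ ih₂ => exact and_congr ih₁ ih₂
  | disj φ ψ ih₁ ih₂ => exact or_congr ih₁ ih₂
  | imp φ ψ ih₁ ih₂ =>
    refine ⟨fun h => h.mono hxy, fun h z hz => ?_⟩
    rcases hz.eq_or_lt with rfl | hz
    · exact fun hx => ih₂.2 (h y le_rfl (ih₁.1 hx))
    · exact h z (by rw [← Set.mem_Ici, ← hI]; exact hz)

theorem exists_border_ge (hfin : ∀ x : M, (Set.Ici x).Finite) {q : Fin n} {x : M}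
    (h : q ∉ c x) : ∃ y, x ≤ y ∧ IsBorder c q y := by
  have hf : (Set.Ici x ∩ {y | q ∉ c y}).Finite := (hfin x).subset Set.inter_subset_left
  obtain ⟨y, hxy, hy⟩ := hf.exists_le_maximal (a := x) ⟨le_rfl, h⟩
  exact ⟨y, hxy, hy.prop.2, fun z hz hyz => hy.le_of_ge ⟨hxy.trans hyz, hz⟩ hyz⟩

theorem IsBorder.notMem {q : Fin n} {x : M} (h : IsBorder c q x) : q ∉ c x := h.prop

theorem IsBorder.mem_of_lt {q : Fin n} {x y : M} (h : IsBorder c q x) (hxy : x < y) : q ∈ c y := by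
  by_contra hy
  exact hxy.not_ge (h.le_of_ge hy hxy.le)

theorem isBorder_iff {q : Fin n} {x : M} : IsBorder c q x ↔ q ∉ c x ∧ ∀ y, x < y → q ∈ c y := by
  refine ⟨fun h => ⟨h.notMem, fun y => h.mem_of_lt⟩, fun h => ⟨h.1, fun y hy hxy => ?_⟩⟩
  by_contra hc
  exact hy (h.2 y (lt_of_le_not_ge hxy hc))

/-- Satisfaction of meet-implication formulas is determined by the submodel of separated points. -/
theorem sat_iff_separated (hfin : ∀ x : M, (Set.Ici x).Finite) {φ : Formula n} (hφ : φ.IsMeetImp)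
    (x : M) : Sat c x φ ↔
      ∀ y : {y : M // Separated c y}, x ≤ y.1 → Sat (restrict c (Separated c)) y φ := by
  induction φ generalizing x with
  | var i =>
    refine ⟨fun h y hy => c.monotone hy h, fun h => ?_⟩
    -- By image-finiteness, a variable that fails at `x` fails at some border point above `x`.
    by_contra hc
    obtain ⟨y, hxy, hy⟩ := exists_border_ge hfin hc
    exact hy.notMem (h ⟨y, i, hy⟩ hxy)
  | bot => exact hφ.elim
  | top => exact ⟨fun _ _ _ => trivial, fun _ => trivial⟩
  | conj φ ψ ih₁ ih₂ =>
    have e : Sat c x (conj φ ψ) ↔ Sat c x φ ∧ Sat c x ψ := Iff.rfl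
    rw [e, ih₁ hφ.1, ih₂ hφ.2]
    exact ⟨fun h y hy => ⟨h.1 y hy, h.2 y hy⟩,
      fun h => ⟨fun y hy => (h y hy).1, fun y hy => (h y hy).2⟩⟩
  | disj => exact hφ.elim
  | imp φ ψ ih₁ ih₂ =>
    constructor
    · intro h y hxy z hyz hz
      -- `z` is itself separated, so truth at `z` in the submodel lifts to truth at `z` in the whole
      -- model.
      have h' := h z.1 (hxy.trans hyz) ((ih₁ hφ.1 z.1).2 fun u hu => hz.mono hu)
      exact (ih₂ hφ.2 z.1).1 h' z le_rfl
    · intro h y hxy hy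
      rw [ih₂ hφ.2]
      exact fun z hz => h z (hxy.trans hz) z le_rfl ((ih₁ hφ.1 y).1 hy z hz)

/-- The theory of a point. -/
def theory (c : M →o Set (Fin n)) (x : M) : Canonical n where
  val := {φ | Sat c x φ}
  property := ⟨fun _ h => h.sat fun _ => id, id, fun _ _ => id⟩

theorem theory_mono {x y : M} (h : x ≤ y) : theory c x ≤ theory c y := fun _ hφ => hφ.mono h

/-- This is the back condition for the map to theories. If `T` differed from the theories of the
finitely many points y ≥ x, choose for each y a pair α_y ∈ T, β_y ∉ T such that y does not satisfy
α_y without β_y. Then ⋀ α_y → ⋁ β_y holds at `x`, hence lies in `T`, against primality. -/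
theorem exists_theory_eq {x : M} (hfin : (Set.Ici x).Finite) {T : Canonical n}
    (hT : theory c x ≤ T) : ∃ y, x ≤ y ∧ theory c y = T := by
  by_contra! hc
  have hsep : ∀ y, ∃ χ : Formula n × Formula n, x ≤ y →
      χ.1 ∈ T.1 ∧ χ.2 ∉ T.1 ∧ (Sat c y χ.1 → Sat c y χ.2) := by
    intro y
    by_cases hxy : x ≤ y
    · by_cases hs : theory c y ≤ T
      · obtain ⟨ψ, hψ, hψ'⟩ := Set.not_subset.1 fun h => hc y hxy (hs.antisymm h)
        exact ⟨(ψ, bot), fun _ => ⟨hψ, T.2.consistent, fun h => (hψ' h).elim⟩⟩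
      · obtain ⟨ψ, hψ, hψ'⟩ := Set.not_subset.1 hs
        exact ⟨(top, ψ), fun _ => ⟨T.2.closed _ .topI, hψ', fun _ => hψ⟩⟩
    · exact ⟨(top, top), fun h => (hxy h).elim⟩
  choose χ hχ using hsep
  have key : ∀ F : Set M, F.Finite → F ⊆ Set.Ici x → ∃ α β : Formula n,
      α ∈ T.1 ∧ β ∉ T.1 ∧ ∀ y ∈ F, Sat c y α → Sat c y β := by
    intro F hF
    induction F, hF using Set.Finite.induction_on with
    | empty => exact fun _ => ⟨top, bot, T.2.closed _ .topI, T.2.consistent, by simp⟩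
    | @insert a F _ _ ih =>
      intro hs
      obtain ⟨α, β, hα, hβ, h⟩ := ih ((Set.subset_insert _ _).trans hs)
      obtain ⟨h₁, h₂, h₃⟩ := hχ a (hs (Set.mem_insert _ _))
      refine ⟨conj (χ a).1 α, disj (χ a).2 β, T.2.mem_conj.2 ⟨h₁, hα⟩,
        fun h => (T.2.mem_disj.1 h).elim h₂ hβ, ?_⟩
      rintro y (rfl | hy) hsat
      · exact .inl (h₃ hsat.1)
      · exact .inr (h y hy hsat.2)
  obtain ⟨α, β, hα, hβ, h⟩ := key _ hfin subset_rfl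
  exact hβ (T.2.mem_of_imp (hT (show Sat c x (imp α β) from h)) hα)

/-- The map from an image-finite model to the universal model. -/
def toUniv (c : M →o Set (Fin n)) (hfin : ∀ x : M, (Set.Ici x).Finite) (x : M) : Univ n where
  val := theory c x
  property := by
    refine ((hfin x).image (theory c)).subset fun T hT => ?_
    obtain ⟨y, hy, rfl⟩ := exists_theory_eq (hfin x) hT
    exact ⟨y, hy, rfl⟩

theorem isPMorphism_toUniv (hfin : ∀ x : M, (Set.Ici x).Finite) :
    IsPMorphism c (univColour n) (toUniv c hfin) where
  monotone _ _ h := theory_mono h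
  back x y hxy := by
    obtain ⟨z, hz, h⟩ := exists_theory_eq (hfin x) hxy
    exact ⟨z, hz, Subtype.ext h⟩
  colour _ := rfl

end Semantics

/-! ### The canonical and the universal model -/

theorem sat_canonical_iff (φ : Formula n) (T : Canonical n) :
    Sat (canonicalColour n) T φ ↔ φ ∈ T.1 := by
  induction φ generalizing T with
  | var i => exact Iff.rfl
  | bot => exact ⟨False.elim, T.2.consistent⟩
  | top => exact ⟨fun _ => T.2.closed _ .topI, fun _ => trivial⟩
  | conj φ ψ ih₁ ih₂ => rw [T.2.mem_conj, ← ih₁, ← ih₂]; rfl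
  | disj φ ψ ih₁ ih₂ => rw [T.2.mem_disj, ← ih₁, ← ih₂]; rfl
  | imp φ ψ ih₁ ih₂ =>
    constructor
    · intro h
      by_contra hc
      obtain ⟨T', hT, hφ, hψ⟩ := T.exists_of_imp_notMem hc
      exact hψ ((ih₂ T').1 (h T' hT ((ih₁ T').2 hφ)))
    · exact fun h T' hT hφ => (ih₂ T').2 (T'.2.mem_of_imp (hT h) ((ih₁ T').1 hφ))

theorem sat_univ_iff (φ : Formula n) (w : Univ n) : Sat (univColour n) w φ ↔ φ ∈ w.1.1 := by
  rw [← sat_canonical_iff]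
  exact sat_restrict_iff (fun x y h hx => hx.subset (Set.Ici_subset_Ici.2 h)) φ w

theorem univ_ext {x y : Univ n} (h : ∀ φ, Sat (univColour n) x φ ↔ Sat (univColour n) y φ) :
    x = y := by
  refine Subtype.ext (Subtype.ext (Set.ext fun φ => ?_))
  rw [← sat_univ_iff, ← sat_univ_iff, h]

theorem IsPMorphism.eq_of_univ {M : Type*} [PartialOrder M] {c : M →o Set (Fin n)}
    {f g : M → Univ n} (hf : IsPMorphism c (univColour n) f) (hg : IsPMorphism c (univColour n) g) :
    f = g :=
  funext fun x => univ_ext fun φ => by rw [hf.sat_iff, hg.sat_iff]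

/-! ### The finite model property -/

/-- The set of subformulas of a formula. -/
def Formula.subformulas : Formula n → Set (Formula n)
  | var i => {var i}
  | bot => {bot}
  | top => {top}
  | conj φ ψ => insert (conj φ ψ) (subformulas φ ∪ subformulas ψ)
  | disj φ ψ => insert (disj φ ψ) (subformulas φ ∪ subformulas ψ)
  | imp φ ψ => insert (imp φ ψ) (subformulas φ ∪ subformulas ψ)

theorem Formula.finite_subformulas (φ : Formula n) : φ.subformulas.Finite := by
  induction φ with
  | var | bot | top => exact Set.finite_singleton _
  | conj _ _ ih₁ ih₂ | disj _ _ ih₁ ih₂ | imp _ _ ih₁ ih₂ => exact (ih₁.union ih₂).insert _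

theorem Formula.self_mem_subformulas (φ : Formula n) : φ ∈ φ.subformulas := by
  cases φ <;> simp [subformulas]

/-- The filtration of the canonical model through a set of formulas. -/
abbrev Filtration (Γ : Set (Formula n)) : Type :=
  {S : Set (Formula n) // ∃ T : Canonical n, T.1 ∩ Γ = S}

/-- The colouring of the filtration. -/
def filtrationColour (Γ : Set (Formula n)) : Filtration Γ →o Set (Fin n) where
  toFun S := {i | var i ∈ S.1}
  monotone' := fun _ _ h _ hi => h hi

theorem sat_filtration_iff {Γ : Set (Formula n)} {φ : Formula n} (hφ : φ.subformulas ⊆ Γ)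
    (S : Filtration Γ) : Sat (filtrationColour Γ) S φ ↔ φ ∈ S.1 := by
  have hΓ : φ ∈ Γ := hφ φ.self_mem_subformulas
  induction φ generalizing S with
  | var i => exact Iff.rfl
  | bot =>
    obtain ⟨_, T, rfl⟩ := S
    exact ⟨False.elim, fun h => T.2.consistent h.1⟩
  | top =>
    obtain ⟨_, T, rfl⟩ := S
    exact ⟨fun _ => ⟨T.2.closed _ .topI, hΓ⟩, fun _ => trivial⟩
  | conj φ ψ ih₁ ih₂ =>
    obtain ⟨h₁, h₂⟩ := Set.union_subset_iff.1 ((Set.subset_insert _ _).trans hφ)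
    have m₁ := h₁ φ.self_mem_subformulas
    have m₂ := h₂ ψ.self_mem_subformulas
    refine (and_congr (ih₁ h₁ S m₁) (ih₂ h₂ S m₂)).trans ?_
    obtain ⟨_, T, rfl⟩ := S
    simp [T.2.mem_conj, m₁, m₂, hΓ]
  | disj φ ψ ih₁ ih₂ =>
    obtain ⟨h₁, h₂⟩ := Set.union_subset_iff.1 ((Set.subset_insert _ _).trans hφ)
    have m₁ := h₁ φ.self_mem_subformulas
    have m₂ := h₂ ψ.self_mem_subformulas
    refine (or_congr (ih₁ h₁ S m₁) (ih₂ h₂ S m₂)).trans ?_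
    obtain ⟨_, T, rfl⟩ := S
    simp [T.2.mem_disj, m₁, m₂, hΓ]
  | imp φ ψ ih₁ ih₂ =>
    obtain ⟨h₁, h₂⟩ := Set.union_subset_iff.1 ((Set.subset_insert _ _).trans hφ)
    have m₁ := h₁ φ.self_mem_subformulas
    have m₂ := h₂ ψ.self_mem_subformulas
    constructor
    · intro h
      obtain ⟨_, T, rfl⟩ := S
      refine ⟨?_, hΓ⟩
      by_contra hc
      obtain ⟨T', hT, hφ', hψ'⟩ := T.exists_of_imp_notMem hc
      have := h ⟨T'.1 ∩ Γ, T', rfl⟩ (Set.inter_subset_inter_left Γ hT)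
        ((ih₁ h₁ _ m₁).2 ⟨hφ', m₁⟩)
      exact hψ' ((ih₂ h₂ _ m₂).1 this).1
    · intro h S' hS hs
      have hs := (ih₁ h₁ S' m₁).1 hs
      refine (ih₂ h₂ S' m₂).2 ?_
      -- The implication belongs to the larger trace, so every prime theory with that trace contains
      -- it.
      have h' := hS h
      obtain ⟨_, T, rfl⟩ := S'
      exact ⟨T.2.mem_of_imp h'.1 hs.1, m₂⟩

/-- Completeness of natural deduction for the universal model. -/
theorem entails_of_val_subset {φ ψ : Formula n}
    (h : val (univColour n) φ ⊆ val (univColour n) ψ) : Entails φ ψ := by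
  by_contra hc
  obtain ⟨T, hφ, hψ⟩ := exists_canonical hc
  set Γ := φ.subformulas ∪ ψ.subformulas
  have hΓf : Γ.Finite := φ.finite_subformulas.union ψ.finite_subformulas
  have : Finite (Filtration Γ) := by
    refine (hΓf.finite_subsets.subset ?_).to_subtype
    rintro _ ⟨T, rfl⟩
    exact Set.inter_subset_right
  -- The filtration is finite, so it maps into `U(n)`, where the hypothesis `h` applies.
  have hp := isPMorphism_toUniv (c := filtrationColour Γ) fun x => Set.toFinite _
  let S : Filtration Γ := ⟨T.1 ∩ Γ, T, rfl⟩
  have hS : Sat (filtrationColour Γ) S φ :=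
    (sat_filtration_iff Set.subset_union_left S).2 ⟨hφ rfl, .inl φ.self_mem_subformulas⟩
  have hS' := (hp.sat_iff ψ S).1 (h ((hp.sat_iff φ S).2 hS))
  exact hψ ((sat_filtration_iff Set.subset_union_right S).1 hS').1

/-! ### The model of the meet-implication fragment -/

theorem separated_finite_Ici (x : {x : Univ n // Separated (univColour n) x}) :
    (Set.Ici x).Finite := by
  have h : ((Subtype.val : {x : Univ n // Separated (univColour n) x} → Univ n) ⁻¹'
      Set.Ici x.1).Finite := (univ_finite_Ici x.1).preimage Subtype.val_injective.injOn
  exact h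

/-- The p-morphism from the separated part of the universal model to the universal model. -/
def separatedToUniv (n : ℕ) : {x : Univ n // Separated (univColour n) x} → Univ n :=
  toUniv (restrict (univColour n) (Separated (univColour n))) separated_finite_Ici

theorem isPMorphism_separatedToUniv (n : ℕ) :
    IsPMorphism (restrict (univColour n) (Separated (univColour n))) (univColour n)
      (separatedToUniv n) :=
  isPMorphism_toUniv _

theorem meetImpSet_univColour (n : ℕ) :
    meetImpSet (univColour n) = Set.range (separatedToUniv n) := by
  ext y
  constructor
  · rintro ⟨f, hf, hy⟩
    rwa [hf.eq_of_univ (isPMorphism_separatedToUniv n)] at hy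
  · exact fun hy => ⟨_, isPMorphism_separatedToUniv n, hy⟩

theorem isUpperSet_meetImpSet (n : ℕ) : IsUpperSet (meetImpSet (univColour n)) := by
  rw [meetImpSet_univColour]
  rintro _ y hxy ⟨x, rfl⟩
  obtain ⟨z, -, rfl⟩ := (isPMorphism_separatedToUniv n).back x y hxy
  exact ⟨z, rfl⟩

theorem sat_univMeetImp_iff (φ : Formula n) (x : UnivMeetImp n) :
    Sat (univMeetImpColour n) x φ ↔ Sat (univColour n) x.1 φ :=
  sat_restrict_iff (fun _ _ h hx => isUpperSet_meetImpSet n h hx) φ x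

/-- The p-morphism maps q-border points to q-border points: a proper successor of the image lifts to
a proper successor of `z`, where q holds. -/
theorem separated_univMeetImp (x : UnivMeetImp n) : Separated (univMeetImpColour n) x := by
  obtain ⟨x, hx⟩ := x
  obtain ⟨z, rfl⟩ : x ∈ Set.range (separatedToUniv n) := by rwa [← meetImpSet_univColour]
  obtain ⟨q, hq⟩ := z.2
  refine ⟨q, isBorder_iff.2 ⟨hq.notMem, ?_⟩⟩
  rintro ⟨y, hy⟩ hlt
  obtain ⟨z', hz', rfl⟩ := (isPMorphism_separatedToUniv n).back z y (le_of_lt hlt)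
  have hne : z.1 ≠ z'.1 := by intro e; obtain rfl := Subtype.ext e; exact lt_irrefl _ hlt
  exact hq.mem_of_lt (lt_of_le_of_ne hz' hne)

theorem univMeetImp_ext {x y : UnivMeetImp n} (hc : univMeetImpColour n x = univMeetImpColour n y)
    (hI : Set.Ioi x = Set.Ioi y) : x = y :=
  Subtype.ext (univ_ext fun φ => by
    rw [← sat_univMeetImp_iff, ← sat_univMeetImp_iff, sat_congr_of_Ioi_eq hc hI])

/-- Completeness of natural deduction on the meet-implication fragment for
`U(n)_{∧,→}`. -/
theorem entails_iff_val_subset {φ ψ : Formula n} (hφ : φ.IsMeetImp) (hψ : ψ.IsMeetImp) :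
    Entails φ ψ ↔ val (univMeetImpColour n) φ ⊆ val (univMeetImpColour n) ψ := by
  refine ⟨Entails.val_subset, fun h => entails_of_val_subset fun x hx => ?_⟩
  refine (sat_iff_separated univ_finite_Ici hψ x).2 fun y hxy => ?_
  have hy := (sat_iff_separated univ_finite_Ici hφ x).1 hx y hxy
  have hf := isPMorphism_separatedToUniv n
  have hm : separatedToUniv n y ∈ meetImpSet (univColour n) := ⟨_, hf, y, rfl⟩
  rw [← hf.sat_iff, ← sat_univMeetImp_iff _ ⟨_, hm⟩] at hy ⊢
  exact h hy

/-! ### Definable up-sets -/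

section Definable

variable {N : Type*} [PartialOrder N] {c : N →o Set (Fin n)}

/-- The set is defined by a meet-implication formula, without `⊤` if there are variables. -/
def MeetImpDefinable (c : N →o Set (Fin n)) (S : Set N) : Prop :=
  ∃ χ : Formula n, χ.IsMeetImp ∧ (0 < n → χ.OmitsTop) ∧ val c χ = S

theorem MeetImpDefinable.var (i : Fin n) : MeetImpDefinable c {x | i ∈ c x} :=
  ⟨.var i, trivial, fun _ => trivial, rfl⟩

theorem MeetImpDefinable.univ : MeetImpDefinable c Set.univ := by
  rcases Nat.eq_zero_or_pos n with h | h
  -- With no variable available, `⊤` is needed; otherwise p → p replaces it.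
  · exact ⟨.top, trivial, fun h' => by omega, Set.eq_univ_of_forall fun _ => trivial⟩
  · exact ⟨.imp (.var ⟨0, h⟩) (.var ⟨0, h⟩), ⟨trivial, trivial⟩, fun _ => ⟨trivial, trivial⟩,
      Set.eq_univ_of_forall fun _ _ _ => id⟩

theorem MeetImpDefinable.inter {S T : Set N} (hS : MeetImpDefinable c S)
    (hT : MeetImpDefinable c T) : MeetImpDefinable c (S ∩ T) := by
  obtain ⟨σ, hσ, hσ', rfl⟩ := hS
  obtain ⟨τ, hτ, hτ', rfl⟩ := hT
  exact ⟨.conj σ τ, ⟨hσ, hτ⟩, fun h => ⟨hσ' h, hτ' h⟩, rfl⟩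

theorem MeetImpDefinable.imp {S T : Set N} (hS : MeetImpDefinable c S)
    (hT : MeetImpDefinable c T) : MeetImpDefinable c {x | ∀ y, x ≤ y → y ∈ S → y ∈ T} := by
  obtain ⟨σ, hσ, hσ', rfl⟩ := hS
  obtain ⟨τ, hτ, hτ', rfl⟩ := hT
  exact ⟨.imp σ τ, ⟨hσ, hτ⟩, fun h => ⟨hσ' h, hτ' h⟩, rfl⟩

theorem MeetImpDefinable.biInter {ι : Type*} {I : Set ι} (hI : I.Finite) {S : ι → Set N}
    (h : ∀ i ∈ I, MeetImpDefinable c (S i)) : MeetImpDefinable c (⋂ i ∈ I, S i) := by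
  induction I, hI using Set.Finite.induction_on with
  | empty => simpa using MeetImpDefinable.univ
  | @insert a I _ _ ih =>
    rw [Set.biInter_insert]
    exact (h a (Set.mem_insert _ _)).inter (ih fun i hi => h i (Set.mem_insert_of_mem _ hi))

theorem Separated.colour_ssubset {x y : N} (hs : Separated c x) (hxy : x < y) : c x ⊂ c y := by
  obtain ⟨q, hq⟩ := hs
  exact (Set.ssubset_iff_of_subset (c.monotone hxy.le)).2 ⟨q, hq.mem_of_lt hxy, hq.notMem⟩

/-- A model is finite if all its points are separated and are determined by their colour and
their proper successors. -/
theorem finite_of_separated (hsep : ∀ x, Separated c x)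
    (hext : ∀ x y, c x = c y → Set.Ioi x = Set.Ioi y → x = y) : Finite N := by
  -- The set consists of the points at which at most `k` variables fail.
  have key : ∀ k : ℕ, {x : N | n ≤ (c x).ncard + k}.Finite := by
    intro k
    induction k with
    | zero =>
      refine Set.finite_empty.subset fun x hx => ?_
      obtain ⟨q, hq⟩ := hsep x
      have h := Set.ncard_lt_ncard
        ((Set.ssubset_univ_iff (s := c x)).2 fun h => hq.notMem (h ▸ Set.mem_univ q))
      rw [Set.ncard_univ, Nat.card_fin] at h
      have hx : n ≤ (c x).ncard + 0 := hx
      omega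
    | succ k ih =>
      -- Proper successors have strictly larger colour, so they lie in the set already known to be
      -- finite.
      refine Set.Finite.of_injOn (f := fun x => (c x, Set.Ioi x))
        (t := Set.univ ×ˢ {A | A ⊆ {x : N | n ≤ (c x).ncard + k}}) ?_ ?_
        (Set.finite_univ.prod ih.finite_subsets)
      · refine fun x hx => ⟨trivial, fun y hy => ?_⟩
        have h := Set.ncard_lt_ncard ((hsep x).colour_ssubset hy)
        have hx : n ≤ (c x).ncard + (k + 1) := hx
        change n ≤ (c y).ncard + k
        omega
      · intro x _ y _ h
        exact hext x y (congrArg Prod.fst h) (congrArg Prod.snd h)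
  exact Set.finite_univ_iff.1 ((key n).subset fun x _ => Nat.le_add_left _ _)

/-- The formula is A → q, where `x` is a q-border point and A resembles a de Jongh formula with q in
place of θ. At a point where q fails, `A₁` and `A₂` bound the colour from below and above, `A₃`
makes all proper successors of `x` visible, and `A₄` hides all other points of larger colour. So a
maximal point of A without q coincides with `x`. Only points of larger colour enter A, so the
recursion is well-founded. -/
theorem meetImpDefinable_compl_Iic [Finite N] (hsep : ∀ x, Separated c x)
    (hext : ∀ x y, c x = c y → Set.Ioi x = Set.Ioi y → x = y) (x : N) :
    MeetImpDefinable c (Set.Iic x)ᶜ := by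
  induction hC : c x using WellFoundedGT.induction generalizing x with
  | ind C ih =>
    subst hC
    obtain ⟨q, hq⟩ := hsep x
    have hV : ∀ v : N, c x ⊂ c v → MeetImpDefinable c (Set.Iic v)ᶜ := fun v hv => ih _ hv v rfl
    let A₁ : Set N := ⋂ p ∈ c x, {y | p ∈ c y}
    let A₂ : Set N := ⋂ r ∈ {r | IsBorder c r x},
      {y | ∀ z, y ≤ z → z ∈ {z | r ∈ c z} → z ∈ {z | q ∈ c z}}
    let A₃ : Set N := ⋂ v ∈ Set.Ioi x, {y | ∀ z, y ≤ z → z ∈ (Set.Iic v)ᶜ → z ∈ {z | q ∈ c z}}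
    let A₄ : Set N := ⋂ v ∈ {v | c x ⊂ c v ∧ ¬ x < v}, (Set.Iic v)ᶜ
    have hA : MeetImpDefinable c (A₁ ∩ (A₂ ∩ (A₃ ∩ A₄))) :=
      (MeetImpDefinable.biInter (Set.toFinite _) fun p _ => .var p).inter <|
        (MeetImpDefinable.biInter (Set.toFinite _) fun r _ =>
          (MeetImpDefinable.var r).imp (.var q)).inter <|
        (MeetImpDefinable.biInter (Set.toFinite _) fun v hv =>
          (hV v ((hsep x).colour_ssubset hv)).imp (.var q)).inter <|
        MeetImpDefinable.biInter (Set.toFinite _) fun v hv => hV v hv.1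
    have hAup : IsUpperSet (A₁ ∩ (A₂ ∩ (A₃ ∩ A₄))) := by
      obtain ⟨χ, -, -, h⟩ := hA
      exact h ▸ isUpperSet_val χ
    convert hA.imp (.var q) using 1
    ext y
    refine ⟨fun hy => ?_, fun hy hyx => hq.notMem (hy x hyx ?_)⟩
    · by_contra hc
      have hne : ∃ z, y ≤ z ∧ z ∈ A₁ ∩ (A₂ ∩ (A₃ ∩ A₄)) ∧ q ∉ c z := by
        by_contra! h
        exact hc h
      obtain ⟨z₀, hz₀⟩ := hne
      obtain ⟨z, -, hz⟩ :=
        (Set.toFinite {z | y ≤ z ∧ z ∈ A₁ ∩ (A₂ ∩ (A₃ ∩ A₄)) ∧ q ∉ c z}).exists_le_maximal hz₀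
      obtain ⟨hyz, hzA, hqz⟩ := hz.prop
      -- As A is an up-set, maximality of `z` makes it a q-border point.
      have hqz' : ∀ z', z < z' → q ∈ c z' := by
        intro z' hz'
        by_contra hcq
        exact hz'.not_ge (hz.le_of_ge ⟨hyz.trans hz'.le, hAup hz'.le hzA, hcq⟩ hz'.le)
      obtain ⟨h₁, h₂, h₃, h₄⟩ := hzA
      simp only [A₁, A₂, A₃, A₄, Set.mem_iInter] at h₁ h₂ h₃ h₄
      have hI : Set.Ioi z = Set.Ioi x := by
        ext v
        constructor
        · intro hv
          by_contra hxv
          exact h₄ v ⟨lt_of_le_of_lt (show c x ≤ c z from h₁) ((hsep z).colour_ssubset hv), hxv⟩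
            (le_of_lt hv)
        · intro hv
          have hle : z ≤ v := by
            by_contra hcv
            exact hqz (h₃ v hv z le_rfl hcv)
          refine lt_of_le_of_ne hle ?_
          rintro rfl
          exact hqz (hq.mem_of_lt hv)
      have hcol : c z = c x := by
        refine Set.Subset.antisymm (fun r hr => ?_) h₁
        by_contra hrx
        -- `r` holds at `z`, hence at all proper successors, which are those of `x`; so `x` is an
        -- r-border point and `A₂` forces q at `z`.
        refine hqz (h₂ r (isBorder_iff.2 ⟨hrx, fun v hv => ?_⟩) z le_rfl hr)
        have hzv : z < v := by rw [← Set.mem_Ioi, hI]; exact hv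
        exact c.monotone hzv.le hr
      exact hy (hext z x hcol hI ▸ hyz)
    -- `x` belongs to A: q holds at every proper successor, so the implications need checking only
    -- at `x`, where their premises fail.
    · simp only [A₁, A₂, A₃, A₄, Set.mem_inter_iff, Set.mem_iInter]
      refine ⟨fun p hp => hp, fun r hr z hz hrz => ?_, fun v hv z hz hzv => ?_, fun v hv hxv => ?_⟩
      · rcases hz.eq_or_lt with rfl | hz
        · exact (IsBorder.notMem hr hrz).elim
        · exact hq.mem_of_lt hz
      · rcases hz.eq_or_lt with rfl | hz
        · exact (hzv (le_of_lt hv)).elim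
        · exact hq.mem_of_lt hz
      · exact hv.2 (lt_of_le_of_ne hxv (by rintro rfl; exact lt_irrefl _ hv.1))

theorem IsUpperSet.meetImpDefinable [Finite N] (hsep : ∀ x, Separated c x)
    (hext : ∀ x y, c x = c y → Set.Ioi x = Set.Ioi y → x = y) {U : Set N} (hU : IsUpperSet U) :
    MeetImpDefinable c U := by
  have e : U = ⋂ x ∈ Uᶜ, (Set.Iic x)ᶜ := by
    ext y
    simp only [Set.mem_iInter]
    refine ⟨fun hy x hx hyx => hx (hU hyx hy), fun h => ?_⟩
    by_contra hy
    exact h y hy le_rfl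
  rw [e]
  exact .biInter (Set.toFinite _) fun x _ => meetImpDefinable_compl_Iic hsep hext x

end Definable

instance finite_univMeetImp : Finite (UnivMeetImp n) :=
  finite_of_separated separated_univMeetImp fun _ _ => univMeetImp_ext

theorem meetImpDefinable_univMeetImp {U : Set (UnivMeetImp n)} (hU : IsUpperSet U) :
    MeetImpDefinable (univMeetImpColour n) U :=
  IsUpperSet.meetImpDefinable separated_univMeetImp (fun _ _ => univMeetImp_ext) hU

/-! ### The translation -/

/-- The union of the two valuations is an up-set of N, hence itself definable in the fragment, so no
upper bound can be smaller. -/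
theorem isMeetImpJoin_iff {σ τ ρ : Formula n} (hσ : σ.IsMeetImp) (hτ : τ.IsMeetImp) :
    IsMeetImpJoin σ τ ρ ↔ ρ.IsMeetImp ∧ val (univMeetImpColour n) ρ =
      val (univMeetImpColour n) σ ∪ val (univMeetImpColour n) τ := by
  constructor
  · intro h
    refine ⟨h.mem, Set.Subset.antisymm ?_
      (Set.union_subset h.left.val_subset h.right.val_subset)⟩
    obtain ⟨χ, hχ, -, e⟩ := meetImpDefinable_univMeetImp
      ((isUpperSet_val (c := univMeetImpColour n) σ).union (isUpperSet_val τ))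
    rw [← e]
    refine (h.least χ hχ ?_ ?_).val_subset
    · rw [entails_iff_val_subset hσ hχ, e]
      exact Set.subset_union_left
    · rw [entails_iff_val_subset hτ hχ, e]
      exact Set.subset_union_right
  · rintro ⟨hρ, e⟩
    refine ⟨hρ, ?_, ?_, fun χ hχ h₁ h₂ => ?_⟩
    · rw [entails_iff_val_subset hσ hρ, e]
      exact Set.subset_union_left
    · rw [entails_iff_val_subset hτ hρ, e]
      exact Set.subset_union_right
    · rw [entails_iff_val_subset hρ hχ, e]
      exact Set.union_subset h₁.val_subset h₂.val_subset

theorem Formula.isMeetImp_bigAnd {l : List (Formula n)} (h : ∀ φ ∈ l, φ.IsMeetImp) :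
    (bigAnd l).IsMeetImp := by
  induction l with
  | nil => trivial
  | cons φ l ih =>
    rw [List.forall_mem_cons] at h
    cases l with
    | nil => exact h.1
    | cons ψ l => exact ⟨h.1, ih h.2⟩

theorem Translates.isMeetImp {φ σ : Formula n} (h : Translates φ σ) : σ.IsMeetImp := by
  induction h with
  | var | top => trivial
  | bot =>
    refine isMeetImp_bigAnd fun φ hφ => ?_
    obtain ⟨i, -, rfl⟩ := List.mem_map.1 hφ
    trivial
  | conj _ _ ih₁ ih₂ => exact ⟨ih₁, ih₂⟩
  | imp _ _ ih₁ ih₂ => exact ⟨ih₁, ih₂⟩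
  | disj _ _ h _ _ => exact h.mem

theorem exists_translates (φ : Formula n) : ∃ σ, Translates φ σ := by
  induction φ with
  | var i => exact ⟨_, .var i⟩
  | bot => exact ⟨_, .bot⟩
  | top => exact ⟨_, .top⟩
  | conj φ ψ ih₁ ih₂ =>
    obtain ⟨σ, hσ⟩ := ih₁
    obtain ⟨τ, hτ⟩ := ih₂
    exact ⟨_, .conj hσ hτ⟩
  | imp φ ψ ih₁ ih₂ =>
    obtain ⟨σ, hσ⟩ := ih₁
    obtain ⟨τ, hτ⟩ := ih₂
    exact ⟨_, .imp hσ hτ⟩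
  | disj φ ψ ih₁ ih₂ =>
    obtain ⟨σ, hσ⟩ := ih₁
    obtain ⟨τ, hτ⟩ := ih₂
    obtain ⟨ρ, hρ, -, e⟩ := meetImpDefinable_univMeetImp
      ((isUpperSet_val (c := univMeetImpColour n) σ).union (isUpperSet_val τ))
    exact ⟨ρ, .disj hσ hτ ((isMeetImpJoin_iff hσ.isMeetImp hτ.isMeetImp).2 ⟨hρ, e⟩)⟩

/-- The translation of a formula is satisfied at the same points of `U(n)_{∧,→}`. -/
theorem Translates.sat_iff {φ σ : Formula n} (h : Translates φ σ) (x : UnivMeetImp n) :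
    Sat (univMeetImpColour n) x σ ↔ Sat (univMeetImpColour n) x φ := by
  induction h generalizing x with
  | var | top => exact Iff.rfl
  | bot =>
    refine ⟨fun h => ?_, False.elim⟩
    obtain ⟨q, hq⟩ := separated_univMeetImp x
    exact hq.notMem
      (sat_bigAnd.1 h (.var q) (List.mem_map.2 ⟨q, List.mem_finRange q, rfl⟩))
  | conj _ _ ih₁ ih₂ => exact and_congr (ih₁ x) (ih₂ x)
  | imp _ _ ih₁ ih₂ =>
    exact forall_congr' fun y => imp_congr Iff.rfl (imp_congr (ih₁ y) (ih₂ y))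
  | disj hσ hτ hρ ih₁ ih₂ =>
    have e := ((isMeetImpJoin_iff hσ.isMeetImp hτ.isMeetImp).1 hρ).2
    exact (Set.ext_iff.1 e x).trans (or_congr (ih₁ x) (ih₂ x))

/-! ### De Jongh formulas -/

theorem mem_enum {α : Type} [Finite α] (a : α) : a ∈ enum α := by
  rw [enum, dif_pos ‹Finite α›]
  simp

theorem finite_covBy (w : Univ n) : Finite {w' : Univ n // w ⋖ w'} :=
  ((univ_finite_Ici w).subset fun _ h => CovBy.le h).to_subtype

theorem exists_covBy_le {w x : Univ n} (h : w < x) : ∃ w', w ⋖ w' ∧ w' ≤ x := by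
  have hf : {y | w < y ∧ y ≤ x}.Finite := (univ_finite_Ici w).subset fun _ h => h.1.le
  obtain ⟨w', hw', hmin⟩ := hf.exists_le_minimal (a := x) ⟨h, le_rfl⟩
  refine ⟨w', ⟨hmin.prop.1, fun y hy hy' => ?_⟩, hw'⟩
  exact hy'.not_ge (hmin.le_of_le ⟨hy, hy'.le.trans hw'⟩ hy'.le)

theorem sat_deJongh_fst {w x : Univ n} : Sat (univColour n) x (deJongh w).1 ↔
    ∃ w', w ⋖ w' ∧ Sat (univColour n) x (deJonghPhi w') := by
  have := finite_covBy w
  rw [deJongh, sat_bigOr]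
  simp only [List.map_map, List.mem_map]
  constructor
  · rintro ⟨_, ⟨w', -, rfl⟩, h⟩
    exact ⟨w'.1, w'.2, h⟩
  · rintro ⟨w', hw, h⟩
    exact ⟨_, ⟨⟨w', hw⟩, mem_enum _, rfl⟩, h⟩

theorem sat_deJonghPhi {w x : Univ n} : Sat (univColour n) x (deJonghPhi w) ↔
    (∀ p ∈ univColour n w, p ∈ univColour n x) ∧
    (∀ q, IsBorder (univColour n) q w → Sat (univColour n) x (imp (var q) (deJongh w).1)) ∧
    ∀ w', w ⋖ w' →
      Sat (univColour n) x (imp (imp (deJonghPhi w') (deJongh w').1) (deJongh w).1) := by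
  have := finite_covBy w
  rw [deJonghPhi, deJongh]
  -- `Sat.eq_4` is the conjunction clause; implications stay folded.
  simp only [Sat.eq_4, sat_bigAnd, List.map_map]
  refine and_congr ?_ (and_congr ?_ ?_)
  · rw [List.forall_mem_map]
    exact ⟨fun h p hp => h ⟨p, hp⟩ (mem_enum _), fun h p _ => h p.1 p.2⟩
  · rw [List.forall_mem_map]
    exact ⟨fun h q hq => h ⟨q, hq⟩ (mem_enum _), fun h q _ => h q.1 q.2⟩
  · rw [List.forall_mem_map]
    exact ⟨fun h w' hw => h ⟨w', hw⟩ (mem_enum _), fun h w' _ => h w'.1 w'.2⟩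

/-- The de Jongh formula of `w` defines the up-set generated by `w`. -/
theorem sat_deJonghPhi_iff (w x : Univ n) : Sat (univColour n) x (deJonghPhi w) ↔ w ≤ x := by
  induction w using WellFoundedGT.induction generalizing x with
  | ind w ihw =>
    -- θ_v defines the set of proper successors of `v`, because every proper successor lies above an
    -- immediate one.
    have hθ (v : Univ n) (hv : w ≤ v) (x : Univ n) (hx : ∀ v', v ⋖ v' →
        (Sat (univColour n) x (deJonghPhi v') ↔ v' ≤ x)) :
        Sat (univColour n) x (deJongh v).1 ↔ v < x := by
      rw [sat_deJongh_fst]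
      constructor
      · rintro ⟨v', hv', h⟩
        exact hv'.lt.trans_le ((hx v' hv').1 h)
      · intro h
        obtain ⟨v', hv', h⟩ := exists_covBy_le h
        exact ⟨v', hv', (hx v' hv').2 h⟩
    have hθw (x : Univ n) : Sat (univColour n) x (deJongh w).1 ↔ w < x :=
      hθ w le_rfl x fun v' hv' => ihw v' hv'.lt x
    -- φ_v → θ_v fails exactly at the points below `v`.
    have hψ (v : Univ n) (hv : w < v) (x : Univ n) :
        Sat (univColour n) x (imp (deJonghPhi v) (deJongh v).1) ↔ ¬ x ≤ v := by
      have e (y : Univ n) : Sat (univColour n) y (deJongh v).1 ↔ v < y :=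
        hθ v hv.le y fun v' hv' => ihw v' (hv.trans hv'.lt) y
      constructor
      · exact fun h hx => lt_irrefl v ((e v).1 (h v hx ((ihw v hv v).2 le_rfl)))
      · intro h y hxy hy
        rw [ihw v hv] at hy
        rw [e]
        refine lt_of_le_of_ne hy ?_
        rintro rfl
        exact h hxy
    constructor
    · intro h
      -- Inner induction from the top: all proper successors of `x` already lie above `w`.
      induction x using WellFoundedGT.induction with
      | ind x ihx =>
        by_contra hwx
        obtain ⟨h₁, h₂, h₃⟩ := sat_deJonghPhi.1 h
        have hx (y : Univ n) (hy : x < y) : w ≤ y := ihx y hy (h.mono hy.le)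
        have hnθ : ¬ Sat (univColour n) x (deJongh w).1 := fun h => hwx ((hθw x).1 h).le
        -- Either `x` has `w` as its only immediate successor, with the same colour, or `x` and `w`
        -- share their colour and proper successors. In both cases their theories coincide, so they
        -- are equal in `U(n)`.
        by_cases hw : x < w
        · refine hw.ne (univ_ext (sat_congr_of_Ioi_eq_Ici ?_ ?_))
          · exact Set.Subset.antisymm ((univColour n).monotone hw.le) h₁
          · exact Set.ext fun y => ⟨hx y, fun hy => hw.trans_le hy⟩
        · have hI : Set.Ioi x = Set.Ioi w := by
            ext y
            refine ⟨fun hy => lt_of_le_of_ne (hx y hy) ?_, fun hy => ?_⟩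
            · rintro rfl
              exact hw hy
            · obtain ⟨w', hw', hle⟩ := exists_covBy_le hy
              have hxw' : x ≤ w' := by
                by_contra hc
                exact hnθ (h₃ w' hw' x le_rfl ((hψ w' hw'.lt x).2 hc))
              refine (lt_of_le_of_ne hxw' ?_).trans_le hle
              rintro rfl
              exact hwx hw'.lt.le
          refine hwx (univ_ext (sat_congr_of_Ioi_eq ?_ hI)).ge
          refine Set.Subset.antisymm (fun q hq => ?_) h₁
          by_contra hqw
          refine hnθ (h₂ q (isBorder_iff.2 ⟨hqw, fun y hy => ?_⟩) x le_rfl hq)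
          have hxy : x < y := by rw [← Set.mem_Ioi, hI]; exact hy
          exact (univColour n).monotone hxy.le hq
    · intro h
      refine Sat.mono (sat_deJonghPhi.2 ⟨fun _ => id, fun q hq y hy hqy => ?_,
        fun w' hw' y hy hyw' => ?_⟩) h
      · rw [hθw]
        refine lt_of_le_of_ne hy ?_
        rintro rfl
        exact hq.notMem hqy
      · rw [hθw]
        refine lt_of_le_of_ne hy ?_
        rintro rfl
        exact (hψ w' hw'.lt w).1 hyw' hw'.lt.le

/-- `φ_U` defines `U` in `U(n)_{∧,→}`. -/
theorem val_upSetFormula {U : Set (UnivMeetImp n)} (hU : IsUpperSet U) :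
    val (univMeetImpColour n) (upSetFormula U) = U := by
  ext x
  change Sat _ x _ ↔ _
  rw [upSetFormula, sat_bigOr]
  simp only [List.mem_map]
  constructor
  · rintro ⟨_, ⟨u, -, rfl⟩, h⟩
    rw [sat_univMeetImp_iff, sat_deJonghPhi_iff] at h
    exact hU h u.2.prop
  · intro hx
    obtain ⟨u, hux, hu⟩ := (Set.toFinite U).exists_le_minimal hx
    refine ⟨_, ⟨⟨u, hu⟩, mem_enum _, rfl⟩, ?_⟩
    rw [sat_univMeetImp_iff, sat_deJonghPhi_iff]
    exact hux

end MeetImp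

theorem theorem3p10 (n : ℕ) :
    -- `U(n)_{∧,→}` is well defined (as the image of the unique p-morphism), an up-set, and finite
    (∃! f : {x : MeetImp.Univ n // MeetImp.Separated (MeetImp.univColour n) x} → MeetImp.Univ n,
      MeetImp.IsPMorphism
        (MeetImp.restrict (MeetImp.univColour n) (MeetImp.Separated (MeetImp.univColour n)))
        (MeetImp.univColour n) f) ∧
    IsUpperSet (MeetImp.meetImpSet (MeetImp.univColour n)) ∧
    Finite (MeetImp.UnivMeetImp n) ∧
    -- every formula has a translation `s(φ)`, which is a meet-implication formula
    (∀ φ : MeetImp.Formula n, ∃ σ, MeetImp.Translates φ σ) ∧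
    (∀ φ σ : MeetImp.Formula n, MeetImp.Translates φ σ → σ.IsMeetImp) ∧
    ∀ U : Set (MeetImp.UnivMeetImp n), IsUpperSet U →
      -- `U` is definable by a meet-implication formula, without `⊤` if there are variables
      (∃ χ : MeetImp.Formula n, χ.IsMeetImp ∧ (0 < n → χ.OmitsTop) ∧
        MeetImp.val (MeetImp.univMeetImpColour n) χ = U) ∧
      -- `U` is defined by `s(φ_U)`
      (∀ σ : MeetImp.Formula n, MeetImp.Translates (MeetImp.upSetFormula U) σ →
        MeetImp.val (MeetImp.univMeetImpColour n) σ = U)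
  := by
  refine ⟨⟨_, MeetImp.isPMorphism_separatedToUniv n,
      fun g hg => hg.eq_of_univ (MeetImp.isPMorphism_separatedToUniv n)⟩,
    MeetImp.isUpperSet_meetImpSet n, MeetImp.finite_univMeetImp, MeetImp.exists_translates,
    fun _ _ h => h.isMeetImp,
    fun U hU => ⟨MeetImp.meetImpDefinable_univMeetImp hU, fun σ hσ => ?_⟩⟩
  rw [← MeetImp.val_upSetFormula hU]
  exact Set.ext hσ.sat_iff
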